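/- \textbf{Setting.} There are $n\ge 1$ bidders and $m\ge 2$ items. A valuation $v:2^{[m]}\to\mathbb R_{\ge 0}$ is monotone, and it is subadditive if $v(S\cup T)\le v(S)+v(T)$ for all $S,T\subseteq[m]$. In a \emph{draft auction}, as long as the set $I$ of unsold items is non-empty, a round is held: each bidder $i$ submits a sealed bid $b_i\ge 0$ and a non-empty set $X_i\subseteq I$; a bidder $i^*$ with the highest bid receives $X_{i^*}$ and pays $b_{i^*}$ for each item of $X_{i^*}$; then $i^*$, $b_{i^*}$ and $X_{i^*}$ are announced. Ties are broken by an arbitrary priority order of the bidders, which may depend on the announcements so far. A (pure) strategy maps each sequence of announcements to a bid and a set. Under a strategy profile $b$, let $S_i(b)$ be the set of items that bidder $i$ gets and $P_i(b)$ her total payment; her utility is $u_i(b;v_i)=v_i(S_i(b))-P_i(b)$, and the welfare is $SW(b)=\sum_i v_i(S_i(b))$. Let $SW(\mathrm{OPT}(v))$ be the maximum of $\sum_i v_i(S_i)$ over all partitions $(S_i)_{i\in[n]}$ of $[m]$ (with empty parts allowed). \textbf{Theorem.} (a) \emph{(Smoothness)} For bidders with subadditive valuations the draft auction is $(\lambda,2)$-smooth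 with $\lambda=\frac{1}{8H_m(\log(m-1)+1)}$, where $H_m=\sum_{k=1}^m\frac1k$ and $\log$ is the natural logarithm (hence also if $\log$ is the binary logarithm): for each subadditive valuation profile $v$ there are maps $b_i'$ from strategies of bidder $i$ to strategies of bidder $i$ such that, for every strategy profile $b$, $$\sum_i u_i\big(b_i'(b_i),b_{-i};v_i\big)\ \ge\ \lambda\, SW(\mathrm{OPT}(v))-2\sum_i P_i(b).$$ (b) \emph{(Price of anarchy)} There is a universal constant $C$ such that, for all $n\ge1$, $m\ge 2$ and all tie-breaking orders, the following hold. (i) \emph{Bayesian setting.} Let the valuations $v_i\sim D_i$ be drawn independently, where $D_i$ is a distribution of subadditive valuations with $\mathbb E[v_i([m])]<\infty$. Let $s$ be a mixed Bayes–Nash equilibrium: each bidder $i$ draws her strategy from a distribution $s_i(v_i)$ that depends on her valuation, and conditionally on $v_i$ no deviation, which may depend on $v_i$, increases her expected utility. Then $$\mathbb E_v[SW(\mathrm{OPT}(v))]\ \le\ C\,(\log m)^2\;\mathbb E[SW(s(v))].$$ (ii) \emph{Complete information.} Let $v$ be a subadditive valuation profile and let $X$ be a correlated equilibrium: a distribution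 of strategy profiles $s$ such that, conditionally on her own suggestion $s_i$, no deviation of bidder $i$, which may depend on $s_i$, increases her expected utility. Then $$SW(\mathrm{OPT}(v))\ \le\ C\,(\log m)^2\;\mathbb E_{s\sim X}[SW(s)].$$ -/

import Mathlib

open MeasureTheory ProbabilityTheory
open scoped NNReal ENNReal

universe u

namespace DraftAuction

/-! ### Valuations -/

/-- Set functions on the bundles of `m` items; measurable structure: the finite product one. -/
abbrev BundleValuation (m : ℕ) := Finset (Fin m) → ℝ

/-- Non-negative, monotone, subadditive (complement-free) valuations. -/
structure IsSubadditiveValuation {m : ℕ} (v : BundleValuation m) : Prop where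
  nonneg : ∀ S, 0 ≤ v S
  mono : ∀ S T, S ⊆ T → v S ≤ v T
  subadd : ∀ S T, v (S ∪ T) ≤ v S + v T

/-- The optimal welfare `SW(OPT(v))`: the largest value of `∑ i, v i (S i)` over the partitions
of the items into bundles `S i`, possibly empty. A partition is given by the map `a` that sends
each item to its owner. -/
noncomputable def optWelfare {n m : ℕ} (v : Fin n → BundleValuation m) : ℝ :=
  ⨆ a : Fin m → Fin n, ∑ i, v i (Finset.univ.filter (fun j => a j = i))

/-! ### The auction -/

/-- The public announcement of one round: the winner, the winning bid, the bundle bought. -/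
abbrev Announcement (n m : ℕ) := Fin n × ℝ≥0 × Finset (Fin m)

/-- The publicly observed history of the first `t` rounds. -/
abbrev History (n m t : ℕ) := Fin t → Announcement n m

/-- The set of items that are still for sale after a history. -/
def remaining {n m t : ℕ} (h : History n m t) : Finset (Fin m) :=
  Finset.univ \ Finset.univ.biUnion (fun s => (h s).2.2)

/-- The items that bidder `i` has bought in a history. -/
def allocation {n m t : ℕ} (h : History n m t) (i : Fin n) : Finset (Fin m) :=
  (Finset.univ.filter (fun s => (h s).1 = i)).biUnion (fun s => (h s).2.2)

/-- The total payment of bidder `i` in a history: her bid for each item of each bundle bought. -/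
noncomputable def payment {n m t : ℕ} (h : History n m t) (i : Fin n) : ℝ :=
  ∑ s, if (h s).1 = i then ((h s).2.1 : ℝ) * (h s).2.2.card else 0

/-- A (pure) strategy of a bidder: for every public history a bid and a demanded bundle of
remaining items, which is non-empty as long as items remain (so that the auction ends). -/
@[ext]
structure Strategy (n m : ℕ) where
  act : ∀ t : ℕ, History n m t → ℝ≥0 × Finset (Fin m)
  measurable_act : ∀ t, Measurable (act t)
  subset_remaining : ∀ t h, (act t h).2 ⊆ remaining h
  nonempty_of_remaining : ∀ t h, (remaining h).Nonempty → (act t h).2.Nonempty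

/-- A tie-breaking rule: before each round, the history determines an arbitrary strict priority
order of the bidders. The order may be the same at all histories. -/
structure TieBreak (n m : ℕ) where
  rank : ∀ t : ℕ, History n m t → Equiv.Perm (Fin n)
  measurable_rank : ∀ t i, Measurable (fun h => rank t h i)

theorem exists_winner {n : ℕ} [NeZero n] (π : Equiv.Perm (Fin n)) (bid : Fin n → ℝ≥0) :
    ∃ i, ∀ j, bid j < bid i ∨ (bid j = bid i ∧ π j ≤ π i) := by
  obtain ⟨i, hi⟩ := Finite.exists_max (fun i => toLex (bid i, π i))
  refine ⟨i, fun j => ?_⟩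
  simpa [Prod.Lex.toLex_le_toLex] using hi j

/-- The winner of a round: the bidder of highest rank among the bidders with the highest bid
(unique, since `π` is injective). -/
noncomputable def winner {n : ℕ} [NeZero n] (π : Equiv.Perm (Fin n)) (bid : Fin n → ℝ≥0) : Fin n :=
  (exists_winner π bid).choose

/-- The history of the first `t` rounds when the bidders play the strategies `b`. Once no item
remains, the rounds are void: an empty bundle is sold for a payment of `0`. -/
noncomputable def play {n m : ℕ} [NeZero n] (tb : TieBreak n m) (b : Fin n → Strategy n m) :
    ∀ t : ℕ, History n m t
  | 0 => Fin.elim0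
  | t + 1 =>
    let h := play tb b t
    let w := winner (tb.rank t h) (fun i => ((b i).act t h).1)
    Fin.snoc (α := fun _ => Announcement n m) h (w, (b w).act t h)

/-- The complete history. Each round sells at least one item while items remain, so that
`m` rounds sell all `m` items. -/
noncomputable def outcome {n m : ℕ} [NeZero n] (tb : TieBreak n m) (b : Fin n → Strategy n m) :
    History n m m :=
  play tb b m

/-- The quasi-linear utility `v(S_i) - P_i` of bidder `i` with valuation `v`. -/
noncomputable def utility {n m : ℕ} [NeZero n] (tb : TieBreak n m) (b : Fin n → Strategy n m)
    (i : Fin n) (v : BundleValuation m) : ℝ :=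
  v (allocation (outcome tb b) i) - payment (outcome tb b) i

/-- The social welfare `∑ i, v_i(S_i)`. -/
noncomputable def welfare {n m : ℕ} [NeZero n] (tb : TieBreak n m) (b : Fin n → Strategy n m)
    (v : Fin n → BundleValuation m) : ℝ :=
  ∑ i, v i (allocation (outcome tb b) i)

/-- `(lam, mu)`-smoothness of the draft auction for a class of valuations: for each valuation
profile every bidder has a deviation that depends only on her own strategy, such that the
inequality below holds at every strategy profile. -/
def IsSmooth {n m : ℕ} [NeZero n] (tb : TieBreak n m) (V : BundleValuation m → Prop) (lam mu : ℝ) : Prop :=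
  ∀ v : Fin n → BundleValuation m, (∀ i, V (v i)) →
    ∃ dev : Fin n → Strategy n m → Strategy n m, ∀ b : Fin n → Strategy n m,
      lam * optWelfare v - mu * ∑ i, payment (outcome tb b) i ≤
        ∑ i, utility tb (Function.update b i (dev i (b i))) i (v i)

/-! ### Randomized strategies and equilibria -/

/-- A family of strategies with parameter `θ : Θ` in a measurable space, jointly measurable in
the parameter and the history. A distribution over strategies is given by a distribution of the
parameter: the space of all strategies itself carries no measurable structure for which playing
the auction is measurable. -/
structure StrategyFamily (n m : ℕ) (Θ : Type u) [MeasurableSpace Θ] where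
  toFun : Θ → Strategy n m
  measurable_toFun : ∀ t, Measurable (fun x : Θ × History n m t => (toFun x.1).act t x.2)

instance {n m : ℕ} {Θ : Type u} [MeasurableSpace Θ] :
    CoeFun (StrategyFamily n m Θ) (fun _ => Θ → Strategy n m) :=
  ⟨StrategyFamily.toFun⟩

/-- The law of types and randomized strategies in the Bayesian setting: independently for the
bidders `i`, the valuation `v_i` is drawn from `D i`, and then the parameter of her strategy from
the distribution `κ i v_i` that her mixed strategy assigns to `v_i`. -/
noncomputable def bayesLaw {n m : ℕ} {Θ : Fin n → Type u} [∀ i, MeasurableSpace (Θ i)]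
    (D : Fin n → Measure (BundleValuation m)) (κ : ∀ i, Kernel (BundleValuation m) (Θ i)) :
    Measure (∀ i, BundleValuation m × Θ i) :=
  Measure.pi (fun i => D i ⊗ₘ κ i)

/-- Mixed Bayes–Nash equilibrium: conditionally on her own valuation, no bidder gains by a
deviation `d`, which may depend on her valuation. For valuations with finite expectation,
utilities are bounded above by an integrable function: a deviation whose utility is not
integrable has expected utility `-∞`, and an equilibrium utility has to be integrable because
bidding `0` guarantees a non-negative utility. -/
structure IsBayesNash {n m : ℕ} [NeZero n] (tb : TieBreak n m)
    {Θ : Fin n → Type u} [∀ i, MeasurableSpace (Θ i)]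
    (D : Fin n → Measure (BundleValuation m)) (κ : ∀ i, Kernel (BundleValuation m) (Θ i))
    (s : ∀ i, StrategyFamily n m (Θ i)) : Prop where
  integrable : ∀ i, Integrable (fun ω => utility tb (fun j => s j (ω j).2) i (ω i).1) (bayesLaw D κ)
  best_response : ∀ (i : Fin n) (d : StrategyFamily n m (BundleValuation m)),
    Integrable (fun ω => utility tb
      (Function.update (fun j => s j (ω j).2) i (d (ω i).1)) i (ω i).1) (bayesLaw D κ) →
    (bayesLaw D κ)[fun ω => utility tb
      (Function.update (fun j => s j (ω j).2) i (d (ω i).1)) i (ω i).1 |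
        MeasurableSpace.comap (fun ω => (ω i).1) inferInstance]
    ≤ᵐ[bayesLaw D κ]
    (bayesLaw D κ)[fun ω => utility tb (fun j => s j (ω j).2) i (ω i).1 |
        MeasurableSpace.comap (fun ω => (ω i).1) inferInstance]

/-- Correlated equilibrium for the valuation profile `v`: `X` is the joint distribution of the
suggestions, where `θ i` suggests the strategy `s i (θ i)` to bidder `i`. Conditionally on her
own suggestion, no bidder gains by a deviation `d`, which may depend on the suggestion. -/
structure IsCorrelatedEq {n m : ℕ} [NeZero n] (tb : TieBreak n m) (v : Fin n → BundleValuation m)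
    {Θ : Fin n → Type u} [∀ i, MeasurableSpace (Θ i)]
    (X : Measure (∀ i, Θ i)) (s : ∀ i, StrategyFamily n m (Θ i)) : Prop where
  integrable : ∀ i, Integrable (fun θ => utility tb (fun j => s j (θ j)) i (v i)) X
  best_response : ∀ (i : Fin n) (d : StrategyFamily n m (Θ i)),
    Integrable (fun θ => utility tb
      (Function.update (fun j => s j (θ j)) i (d (θ i))) i (v i)) X →
    X[fun θ => utility tb (Function.update (fun j => s j (θ j)) i (d (θ i))) i (v i) |
        MeasurableSpace.comap (fun θ => θ i) inferInstance]
    ≤ᵐ[X]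
    X[fun θ => utility tb (fun j => s j (θ j)) i (v i) |
        MeasurableSpace.comap (fun θ => θ i) inferInstance]

end DraftAuction

open DraftAuction

/-! A subadditive valuation contains a good homogeneous one. Let `rate v T` be the least value per
item among the non-empty subsets of `T`, so that `v` is at least `rate v T` times the number of
items on subsets of `T`. Repeatedly removing the subset with the lowest value per item shows that
every `S` has a subset `T` whose guaranteed value is at least `v S / H_m` (`exists_guarantee`).
Hence some disjoint targets have guarantees summing to at least `OPT / H_m`.

Bidder `i` deviates by imitating her strategy, except that she offers `q = rate / 2` for the rest of
her target whenever her own bid is below `q`. A losing bid is not announced, so the auction runs as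
before until this offer wins, and until then every item of the target is sold for at least `q`. Each
target item is therefore either obtained at half its guaranteed value or paid for in the original
play (`play_homogeneousDev`). The loss is `P_i` plus the money spent on the target; summed over
disjoint targets, this is at most twice the revenue. This proves `(1 / (2 H_m), 2)`-smoothness,
which is stronger than required.

In equilibrium, smoothness and non-negative expected utilities give `OPT ≤ 4 H_m · SW`. Under
complete information the deviation is available as it stands. In the Bayesian setting a bidder
resamples the valuations of the others and her own strategy; swapping her coordinate between two
independent copies reduces this to smoothness with valuations independent of the strategies. -/

namespace DraftAuction

/-! ### Histories extended by one round -/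

section History

variable {n m t : ℕ} (h : History n m t) (a : Announcement n m)

/-- The history `h` followed by the announcement `a`. -/
def extend : History n m (t + 1) :=
  Fin.snoc (α := fun _ => Announcement n m) h a

/-- The total price paid, by all bidders, for the items of `T`. -/
noncomputable def spent (h : History n m t) (T : Finset (Fin m)) : ℝ :=
  ∑ s, ((h s).2.1 : ℝ) * (T ∩ (h s).2.2).card

@[simp] theorem extend_castSucc (s : Fin t) : extend h a s.castSucc = h s := by
  simp [extend]

@[simp] theorem extend_last : extend h a (Fin.last t) = a := by
  simp [extend]

theorem mem_remaining {j : Fin m} : j ∈ remaining h ↔ ∀ s, j ∉ (h s).2.2 := by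
  simp [remaining]

theorem mem_allocation {i : Fin n} {j : Fin m} :
    j ∈ allocation h i ↔ ∃ s, (h s).1 = i ∧ j ∈ (h s).2.2 := by
  simp [allocation]

theorem remaining_extend : remaining (extend h a) = remaining h \ a.2.2 := by
  ext j
  simp [mem_remaining, Fin.forall_fin_succ']

theorem allocation_extend_subset (i : Fin n) : allocation h i ⊆ allocation (extend h a) i := by
  intro j
  simp only [mem_allocation, Fin.exists_fin_succ', extend_castSucc]
  exact Or.inl

theorem subset_allocation_extend {i : Fin n} (hi : a.1 = i) :
    a.2.2 ⊆ allocation (extend h a) i := by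
  intro j hj
  simp only [mem_allocation, Fin.exists_fin_succ', extend_last]
  exact Or.inr ⟨hi, hj⟩

theorem payment_extend (i : Fin n) :
    payment (extend h a) i =
      payment h i + if a.1 = i then (a.2.1 : ℝ) * a.2.2.card else 0 := by
  simp [payment, Fin.sum_univ_castSucc]

theorem spent_extend (T : Finset (Fin m)) :
    spent (extend h a) T = spent h T + (a.2.1 : ℝ) * (T ∩ a.2.2).card := by
  simp [spent, Fin.sum_univ_castSucc]

theorem payment_nonneg (i : Fin n) : 0 ≤ payment h i :=
  Finset.sum_nonneg fun s _ => by split_ifs <;> positivity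

theorem payment_le_payment_extend (i : Fin n) : payment h i ≤ payment (extend h a) i := by
  rw [payment_extend]
  split_ifs
  · exact le_add_of_nonneg_right (by positivity)
  · simp

theorem spent_le_spent_extend (T : Finset (Fin m)) : spent h T ≤ spent (extend h a) T := by
  rw [spent_extend]
  exact le_add_of_nonneg_right (by positivity)

theorem sum_payment : ∑ i, payment h i = ∑ s, ((h s).2.1 : ℝ) * (h s).2.2.card := by
  simp only [payment]
  rw [Finset.sum_comm]
  simp

/-- Disjoint sets meet a sold bundle in disjoint parts, so no payment is counted twice. -/
theorem sum_spent_le_sum_payment (T : Fin n → Finset (Fin m))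
    (hT : Pairwise fun i j => Disjoint (T i) (T j)) :
    ∑ i, spent h (T i) ≤ ∑ i, payment h i := by
  rw [sum_payment]
  simp only [spent]
  rw [Finset.sum_comm]
  refine Finset.sum_le_sum fun s _ => ?_
  rw [← Finset.mul_sum]
  refine mul_le_mul_of_nonneg_left ?_ (by positivity)
  rw [← Nat.cast_sum, ← Finset.card_biUnion]
  · exact_mod_cast Finset.card_le_card (Finset.biUnion_subset.2 fun _ _ => Finset.inter_subset_right)
  · exact fun i _ j _ hij => (hT hij).mono Finset.inter_subset_left Finset.inter_subset_left

end History

/-! ### The course of the auction -/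

theorem winner_spec {n : ℕ} [NeZero n] (π : Equiv.Perm (Fin n)) (bid : Fin n → ℝ≥0) (j : Fin n) :
    bid j < bid (winner π bid) ∨ (bid j = bid (winner π bid) ∧ π j ≤ π (winner π bid)) :=
  (exists_winner π bid).choose_spec j

theorem winner_eq_iff {n : ℕ} [NeZero n] (π : Equiv.Perm (Fin n)) (bid : Fin n → ℝ≥0) (i : Fin n) :
    winner π bid = i ↔ ∀ j, bid j < bid i ∨ (bid j = bid i ∧ π j ≤ π i) := by
  refine ⟨fun h j => h ▸ winner_spec π bid j, fun h => ?_⟩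
  rcases winner_spec π bid i with h₁ | ⟨h₁, h₂⟩ <;>
    rcases h (winner π bid) with h₃ | ⟨h₃, h₄⟩
  · exact absurd h₁ h₃.not_gt
  · exact absurd h₁ h₃.not_gt
  · exact absurd h₃ h₁.not_gt
  · exact π.injective (le_antisymm h₄ h₂)

theorem bid_le_winner {n : ℕ} [NeZero n] (π : Equiv.Perm (Fin n)) (bid : Fin n → ℝ≥0) (j : Fin n) :
    bid j ≤ bid (winner π bid) := by
  rcases winner_spec π bid j with h | h
  exacts [h.le, h.1.le]

/-- Lowering the bid of a losing bidder does not change the winner. -/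
theorem winner_eq_of_le {n : ℕ} [NeZero n] (π : Equiv.Perm (Fin n)) {bid bid' : Fin n → ℝ≥0}
    (hle : ∀ j, bid' j ≤ bid j) (heq : bid' (winner π bid) = bid (winner π bid)) :
    winner π bid' = winner π bid := by
  rw [winner_eq_iff]
  intro j
  rw [heq]
  rcases winner_spec π bid j with h | ⟨h, h'⟩
  · exact Or.inl ((hle j).trans_lt h)
  · rcases ((hle j).trans h.le).lt_or_eq with h₁ | h₁
    exacts [Or.inl h₁, Or.inr ⟨h₁, h'⟩]

section Play

variable {n m : ℕ} [NeZero n] (tb : TieBreak n m) (b : Fin n → Strategy n m)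

/-- The winner of the round that follows the first `t` rounds. -/
noncomputable def nextWinner (t : ℕ) : Fin n :=
  winner (tb.rank t (play tb b t)) (fun i => ((b i).act t (play tb b t)).1)

theorem play_succ (t : ℕ) :
    play tb b (t + 1) = extend (play tb b t)
      (nextWinner tb b t, (b (nextWinner tb b t)).act t (play tb b t)) := rfl

theorem card_remaining_play (t : ℕ) : (remaining (play tb b t)).card ≤ m - t := by
  induction t with
  | zero => exact (Finset.card_le_univ _).trans (by simp)
  | succ t ih =>
    rw [play_succ, remaining_extend]
    rcases (remaining (play tb b t)).eq_empty_or_nonempty with h | h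
    · simp [h]
    · have h₁ := (b (nextWinner tb b t)).nonempty_of_remaining t _ h
      have h₂ := (b (nextWinner tb b t)).subset_remaining t (play tb b t)
      rw [Finset.card_sdiff_of_subset h₂]
      have := h₁.card_pos
      omega

theorem remaining_outcome : remaining (outcome tb b) = ∅ := by
  simpa [outcome] using card_remaining_play tb b m

theorem payment_play_eq_zero {i : Fin n} (hi : ∀ t h, ((b i).act t h).1 = 0) (t : ℕ) :
    payment (play tb b t) i = 0 := by
  induction t with
  | zero => simp [payment]
  | succ t ih =>
    rw [play_succ, payment_extend, ih]
    split_ifs with h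
    · simp only at h
      simp [h, hi]
    · simp

end Play

/-! ### The deviation to a homogeneous valuation -/

section Deviation

variable {n m : ℕ}

theorem measurable_remaining (t : ℕ) : Measurable (remaining : History n m t → Finset (Fin m)) := by
  have : (remaining : History n m t → Finset (Fin m)) =
      (fun X : Fin t → Finset (Fin m) => Finset.univ \ Finset.univ.biUnion X) ∘
        fun h s => (h s).2.2 := rfl
  rw [this]
  exact (Measurable.of_discrete).comp
    (measurable_pi_lambda _ fun s => ((measurable_pi_apply s).snd).snd)

/-- The bid and the bundle of a bidder who wants the items of `T` at the price `q`, who otherwise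
would choose `x`, and for whom the items of `R` are left. -/
noncomputable def homogeneousAction (T : Finset (Fin m)) (q : ℝ≥0) (R : Finset (Fin m))
    (x : ℝ≥0 × Finset (Fin m)) : ℝ≥0 × Finset (Fin m) :=
  if T ∩ R = ∅ then (0, R) else if q ≤ x.1 then x else (q, T ∩ R)

theorem measurable_homogeneousAction :
    Measurable fun p : Finset (Fin m) × ℝ≥0 × Finset (Fin m) × (ℝ≥0 × Finset (Fin m)) =>
      homogeneousAction p.1 p.2.1 p.2.2.1 p.2.2.2 := by
  unfold homogeneousAction
  have hI : Measurable fun p : Finset (Fin m) × ℝ≥0 × Finset (Fin m) × (ℝ≥0 × Finset (Fin m)) =>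
      p.1 ∩ p.2.2.1 :=
    (Measurable.of_discrete (f := fun p : Finset (Fin m) × Finset (Fin m) => p.1 ∩ p.2)).comp
      (measurable_fst.prodMk measurable_snd.snd.fst)
  refine Measurable.ite (hI (measurableSet_singleton ∅)) (by fun_prop) ?_
  exact Measurable.ite (measurableSet_le (by fun_prop) (by fun_prop)) (by fun_prop)
    (Measurable.prodMk (by fun_prop) hI)

/-- Follow `b`, but buy the rest of `T` at the price `q` per item as soon as this is higher than
the bid of `b`. Once no item of `T` is left, bid `0`. -/
noncomputable def homogeneousDev (T : Finset (Fin m)) (q : ℝ≥0) (b : Strategy n m) :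
    Strategy n m where
  act t h := homogeneousAction T q (remaining h) (b.act t h)
  measurable_act t := measurable_homogeneousAction.comp
    (measurable_const.prodMk (measurable_const.prodMk
      ((measurable_remaining t).prodMk (b.measurable_act t))))
  subset_remaining t h := by
    unfold homogeneousAction
    split_ifs
    exacts [subset_rfl, b.subset_remaining t h, Finset.inter_subset_right]
  nonempty_of_remaining t h hR := by
    unfold homogeneousAction
    split_ifs with h₁
    exacts [hR, b.nonempty_of_remaining t h hR, Finset.nonempty_iff_ne_empty.2 h₁]

theorem homogeneousDev_act_of_le {T : Finset (Fin m)} {q : ℝ≥0} {b : Strategy n m} {t : ℕ}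
    {h : History n m t} (h₁ : T ∩ remaining h ≠ ∅) (h₂ : q ≤ (b.act t h).1) :
    (homogeneousDev T q b).act t h = b.act t h := by
  simp [homogeneousDev, homogeneousAction, h₁, h₂]

theorem homogeneousDev_act_of_lt {T : Finset (Fin m)} {q : ℝ≥0} {b : Strategy n m} {t : ℕ}
    {h : History n m t} (h₁ : T ∩ remaining h ≠ ∅) (h₂ : (b.act t h).1 < q) :
    (homogeneousDev T q b).act t h = (q, T ∩ remaining h) := by
  simp [homogeneousDev, homogeneousAction, h₁, h₂]

theorem homogeneousDev_act_of_empty {T : Finset (Fin m)} {q : ℝ≥0} {b : Strategy n m} {t : ℕ}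
    {h : History n m t} (h₁ : T ∩ remaining h = ∅) :
    (homogeneousDev T q b).act t h = (0, remaining h) := by
  simp [homogeneousDev, homogeneousAction, h₁]

variable (i : Fin n) (T : Finset (Fin m)) (q : ℝ≥0)

/-- The state of the deviating bidder once all items of `T` are sold: she has bought at least `k`
of them at the price `q`, and without the deviation the others have been sold for at least `q`. -/
def TargetSold {t : ℕ} (h h' : History n m t) : Prop :=
  ∃ k : ℕ, payment h' i ≤ payment h i + q * k ∧ q * T.card ≤ spent h T + q * k ∧
    k ≤ (T ∩ allocation h' i).card

variable {i T q} in
-- Once `T` is sold the deviator bids `0`, so her payment is frozen, while the original payments and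
-- her allocation only grow.
theorem TargetSold.extend {t : ℕ} {h h' : History n m t} (H : TargetSold i T q h h')
    (a a' : Announcement n m) (ha : a'.1 = i → a'.2.1 = 0) :
    TargetSold i T q (extend h a) (extend h' a') := by
  obtain ⟨k, h₁, h₂, h₃⟩ := H
  refine ⟨k, ?_, h₂.trans (by gcongr; exact spent_le_spent_extend h a T), h₃.trans
    (Finset.card_le_card (Finset.inter_subset_inter_left (allocation_extend_subset h' a' i)))⟩
  have hp : payment (DraftAuction.extend h' a') i = payment h' i := by
    rw [payment_extend]
    split_ifs with hi
    · simp [ha hi]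
    · simp
  rw [hp]
  exact h₁.trans (by gcongr; exact payment_le_payment_extend h a i)

/-- If all items of `T` are sold for at least `q`, then buying none of them is as good. -/
theorem targetSold_self {t : ℕ} {h : History n m t} (hT : T ∩ remaining h = ∅)
    (hs : q * (T \ remaining h).card ≤ spent h T) : TargetSold i T q h h := by
  refine ⟨0, by simp, ?_, by simp⟩
  rw [Finset.sdiff_eq_self_of_disjoint (Finset.disjoint_iff_inter_eq_empty.2 hT)] at hs
  simpa using hs

variable [NeZero n] (tb : TieBreak n m) (b : Fin n → Strategy n m)

/-- Invariant of the rounds: either the deviation has not shown yet and the items of `T` sold so far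
cost at least `q` each, or `T` is sold out and the account is settled for good. -/
theorem play_homogeneousDev (t : ℕ) :
    (play tb (Function.update b i (homogeneousDev T q (b i))) t = play tb b t ∧
      q * (T \ remaining (play tb b t)).card ≤ spent (play tb b t) T) ∨
    (T ∩ remaining (play tb (Function.update b i (homogeneousDev T q (b i))) t) = ∅ ∧
      TargetSold i T q (play tb b t)
        (play tb (Function.update b i (homogeneousDev T q (b i))) t)) := by
  set b' := Function.update b i (homogeneousDev T q (b i)) with hb'
  have hbi : b' i = homogeneousDev T q (b i) := by simp [hb']
  have hbj : ∀ j, j ≠ i → b' j = b j := fun j hj => by simp [hb', hj]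
  induction t with
  | zero =>
    left
    have h0 : remaining (play tb b 0) = Finset.univ := by ext; simp [mem_remaining]
    exact ⟨rfl, by simp [h0, spent, Finset.sdiff_eq_empty_iff_subset.2]⟩
  | succ t ih =>
    have sold : T ∩ remaining (play tb b' t) = ∅ →
        TargetSold i T q (play tb b t) (play tb b' t) →
        T ∩ remaining (play tb b' (t + 1)) = ∅ ∧
          TargetSold i T q (play tb b (t + 1)) (play tb b' (t + 1)) := by
      intro h₁ h₂
      rw [play_succ, play_succ]
      refine ⟨?_, h₂.extend _ _ fun hi => ?_⟩
      · rw [remaining_extend, ← Finset.subset_empty, ← h₁]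
        exact Finset.inter_subset_inter_left Finset.sdiff_subset
      · simp only at hi ⊢
        rw [hi, hbi, homogeneousDev_act_of_empty h₁]
    rcases ih with ⟨heq, hs⟩ | ⟨h₁, h₂⟩
    swap
    · exact Or.inr (sold h₁ h₂)
    by_cases hT : T ∩ remaining (play tb b t) = ∅
    -- The target has just run out without the deviation being noticed: settle with `k = 0`.
    · exact Or.inr (sold (by rw [heq, hT]) (by rw [heq]; exact targetSold_self i T q hT hs))
    set h := play tb b t with hh
    set w := nextWinner tb b t with hw
    -- A round with the same winner, the same action and a winning bid of at least `q` keeps the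
    -- first alternative.
    have same : nextWinner tb b' t = w → (b' w).act t h = (b w).act t h →
        q ≤ ((b w).act t h).1 →
        play tb b' (t + 1) = play tb b (t + 1) ∧
          q * (T \ remaining (play tb b (t + 1))).card ≤ spent (play tb b (t + 1)) T := by
      intro hw' ha hq
      rw [play_succ, play_succ, heq, hw', ← hw, ← hh, ha]
      refine ⟨rfl, ?_⟩
      rw [remaining_extend, spent_extend]
      have hsub : T \ (remaining h \ ((b w).act t h).2) ⊆
          (T \ remaining h) ∪ (T ∩ ((b w).act t h).2) := by
        intro j
        simp only [Finset.mem_sdiff, Finset.mem_union, Finset.mem_inter]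
        tauto
      have hc := (Finset.card_le_card hsub).trans (Finset.card_union_le _ _)
      calc (q : ℝ) * (T \ (remaining h \ ((b w).act t h).2)).card
          ≤ q * ((T \ remaining h).card + (T ∩ ((b w).act t h).2).card) := by
            gcongr
            exact_mod_cast hc
        _ = q * (T \ remaining h).card + q * (T ∩ ((b w).act t h).2).card := by ring
        _ ≤ _ := by
            gcongr
    have hbid : ∀ j, ((b j).act t h).1 ≤ ((b w).act t h).1 := fun j => by
      rw [hw, nextWinner]
      exact bid_le_winner _ (fun j => ((b j).act t h).1) j
    have hw' : nextWinner tb b' t = winner (tb.rank t h) (fun j => ((b' j).act t h).1) := by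
      rw [nextWinner, heq]
    by_cases hq : q ≤ ((b i).act t h).1
    · left
      have hact : ∀ j, (b' j).act t h = (b j).act t h := by
        intro j
        by_cases hj : j = i
        · rw [hj, hbi, homogeneousDev_act_of_le hT hq]
        · rw [hbj j hj]
      refine same ?_ (hact w) (hq.trans (hbid i))
      rw [hw']
      simp only [hact]
      rfl
    · push Not at hq
      have hacti : (b' i).act t h = (q, T ∩ remaining h) := by
        rw [hbi, homogeneousDev_act_of_lt hT hq]
      by_cases hwi : nextWinner tb b' t = i
      · right
        rw [play_succ, play_succ, heq, hwi, ← hw, ← hh, hacti]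
        -- Her offer wins all of `T` that is left. The items of `T` sold earlier are covered by
        -- `hs`.
        refine ⟨?_, (T ∩ remaining h).card, ?_, ?_, ?_⟩
        · rw [remaining_extend]
          ext j
          simp
        · rw [payment_extend]
          simp only [if_true]
          gcongr
          exact payment_le_payment_extend _ _ _
        · have hc : (T.card : ℝ) = (T \ remaining h).card + (T ∩ remaining h).card := by
            exact_mod_cast (Finset.card_sdiff_add_card_inter T (remaining h)).symm
          rw [hc, mul_add]
          gcongr
          exact hs.trans (spent_le_spent_extend _ _ _)
        · refine Finset.card_le_card (Finset.subset_inter Finset.inter_subset_left ?_)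
          exact subset_allocation_extend h (i, q, T ∩ remaining h) rfl
      · left
        -- Her offer `q` loses: lowering it back to the bid of `b i` keeps the winner, whose bid is
        -- at least `q`.
        have hww : nextWinner tb b' t = w := by
          rw [hw']
          refine (winner_eq_of_le (tb.rank t h) (bid := fun j => ((b' j).act t h).1)
            (bid' := fun j => ((b j).act t h).1) (fun j => ?_) ?_).symm
          · by_cases hj : j = i
            · subst hj
              simpa [hacti] using hq.le
            · simp [hbj j hj]
          · rw [← hw']
            simp [hbj _ hwi]
        have hwi' : w ≠ i := hww ▸ hwi
        refine same hww (by rw [hbj w hwi']) ?_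
        have := bid_le_winner (tb.rank t h) (fun j => ((b' j).act t h).1) i
        rw [← hw', hww] at this
        simpa [hacti, hbj w hwi'] using this

theorem targetSold_outcome_homogeneousDev :
    TargetSold i T q (outcome tb b)
      (outcome tb (Function.update b i (homogeneousDev T q (b i)))) := by
  rcases play_homogeneousDev i T q tb b m with ⟨h₁, h₂⟩ | ⟨-, h⟩
  · rw [outcome, outcome, h₁]
    exact targetSold_self i T q (by simp [show remaining (play tb b m) = ∅ from
      remaining_outcome tb b]) h₂
  · exact h

end Deviation

/-! ### Homogeneous lower bounds of subadditive valuations -/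

section Rate

variable {m : ℕ}

/-- The largest `c` such that every subset `U` of `T` has value at least `c * |U|`. -/
noncomputable def rate (v : BundleValuation m) (T : Finset (Fin m)) : ℝ≥0 :=
  ⨅ U : {U : Finset (Fin m) // U ⊆ T ∧ U.Nonempty}, (v U / (U : Finset (Fin m)).card).toNNReal

/-- The value of `T` in the best homogeneous valuation on `T` below `v`. -/
noncomputable def guarantee (v : BundleValuation m) (T : Finset (Fin m)) : ℝ :=
  if T = ∅ then v ∅ else rate v T * T.card

theorem measurable_rate (T : Finset (Fin m)) :
    Measurable fun v : BundleValuation m => rate v T := by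
  unfold rate
  refine Measurable.iInf fun U => ?_
  exact ((measurable_pi_apply _).div_const _).real_toNNReal

theorem measurable_guarantee (T : Finset (Fin m)) :
    Measurable fun v : BundleValuation m => guarantee v T := by
  unfold guarantee
  split_ifs
  · exact measurable_pi_apply _
  · exact (measurable_rate T).coe_nnreal_real.mul_const _

theorem rate_mul_card_le {v : BundleValuation m} (hv : ∀ S, 0 ≤ v S) {T U : Finset (Fin m)}
    (hU : U ⊆ T) : rate v T * U.card ≤ v U := by
  rcases U.eq_empty_or_nonempty with rfl | hne
  · simpa using hv ∅
  have hc : (0 : ℝ) < U.card := by exact_mod_cast hne.card_pos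
  have h : rate v T ≤ (v U / U.card).toNNReal :=
    ciInf_le (OrderBot.bddBelow _) (⟨U, hU, hne⟩ : {U : Finset (Fin m) // U ⊆ T ∧ U.Nonempty})
  rw [← le_div_iff₀ hc]
  have := NNReal.coe_le_coe.2 h
  rwa [Real.coe_toNNReal _ (div_nonneg (hv U) hc.le)] at this

theorem exists_rate_mul_card_eq {v : BundleValuation m} (hv : ∀ S, 0 ≤ v S) {T : Finset (Fin m)}
    (hT : T.Nonempty) : ∃ U ⊆ T, U.Nonempty ∧ v U = rate v T * U.card := by
  have : Nonempty {U : Finset (Fin m) // U ⊆ T ∧ U.Nonempty} := ⟨⟨T, subset_rfl, hT⟩⟩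
  obtain ⟨⟨U, hU, hne⟩, h⟩ := exists_eq_ciInf_of_finite
    (f := fun U : {U : Finset (Fin m) // U ⊆ T ∧ U.Nonempty} =>
      (v U / (U : Finset (Fin m)).card).toNNReal)
  have hc : (0 : ℝ) < U.card := by exact_mod_cast hne.card_pos
  refine ⟨U, hU, hne, ?_⟩
  rw [rate, ← h, Real.coe_toNNReal _ (div_nonneg (hv U) hc.le)]
  field_simp

/-- Each of the `k` additional terms of the harmonic sum is at least `1 / (r + k)`. This pays for
one greedy removal of `k` items. -/
theorem harmonic_add_div_le (r k : ℕ) :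
    (harmonic r : ℝ) + k / (r + k : ℕ) ≤ (harmonic (r + k) : ℝ) := by
  induction k with
  | zero => simp
  | succ k ih =>
    rw [← add_assoc, harmonic_succ]
    push_cast at ih ⊢
    have hk : ((k : ℝ) + 1) / (r + k + 1) ≤ k / (r + k) + (r + k + 1 : ℝ)⁻¹ := by
      rw [add_div, one_div]
      rcases Nat.eq_zero_or_pos (r + k) with h | h
      -- Here `k / (r + k)` is `0 / 0 = 0`.
      · obtain ⟨rfl, rfl⟩ : r = 0 ∧ k = 0 := by omega
        simp
      · have : (0 : ℝ) < r + k := by exact_mod_cast h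
        exact add_le_add_left (div_le_div_of_nonneg_left k.cast_nonneg this (by linarith)) _
    linarith

theorem harmonic_mono {r s : ℕ} (h : r ≤ s) : (harmonic r : ℝ) ≤ harmonic s := by
  obtain ⟨k, rfl⟩ := Nat.exists_eq_add_of_le h
  exact (le_add_of_nonneg_right (by positivity)).trans (harmonic_add_div_le r k)

theorem one_le_harmonic {r : ℕ} (h : 1 ≤ r) : (1 : ℝ) ≤ harmonic r := by
  simpa using harmonic_mono h

/-- Greedily removing the subset with the lowest value per item shows that the best homogeneous
lower bound loses at most a harmonic factor. -/
theorem IsSubadditiveValuation.le_mul_harmonic {v : BundleValuation m}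
    (hv : IsSubadditiveValuation v) {α : ℝ} (S : Finset (Fin m)) :
    S.Nonempty → (∀ T ⊆ S, T.Nonempty → rate v T * T.card ≤ α) → v S ≤ α * harmonic S.card := by
  induction S using Finset.strongInduction with
  | H S ih =>
  intro hS hα
  obtain ⟨U, hUS, hne, hU⟩ := exists_rate_mul_card_eq hv.nonneg hS
  have hα₀ : 0 ≤ α := le_trans (by positivity) (hα S subset_rfl hS)
  have hc : (0 : ℝ) < S.card := by exact_mod_cast hS.card_pos
  rcases (S \ U).eq_empty_or_nonempty with h | h
  · obtain rfl : U = S := hUS.antisymm (Finset.sdiff_eq_empty_iff_subset.1 h)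
    rw [hU]
    exact (hα U subset_rfl hS).trans
      (le_mul_of_one_le_right hα₀ (one_le_harmonic hS.card_pos))
  · have h₁ := ih (S \ U) (Finset.sdiff_ssubset hUS hne) h fun T hT =>
      hα T (hT.trans Finset.sdiff_subset)
    have h₂ : v S ≤ v (S \ U) + v U := by
      have := hv.subadd (S \ U) U
      rwa [Finset.sdiff_union_of_subset hUS] at this
    -- `U` has the lowest value per item in `S`, namely `rate v S ≤ α / |S|`.
    have h₃ : v U ≤ α * (U.card / S.card) := by
      rw [hU]
      have := hα S subset_rfl hS
      rw [← le_div_iff₀ hc] at this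
      calc (rate v S : ℝ) * U.card ≤ α / S.card * U.card := by gcongr
        _ = _ := by ring
    have h₄ := harmonic_add_div_le (S \ U).card U.card
    rw [Finset.card_sdiff_add_card_eq_card hUS] at h₄
    calc v S ≤ α * harmonic (S \ U).card + α * (U.card / S.card) := by linarith
      _ = α * (harmonic (S \ U).card + U.card / S.card) := by ring
      _ ≤ _ := by gcongr

theorem IsSubadditiveValuation.exists_guarantee {v : BundleValuation m}
    (hv : IsSubadditiveValuation v) (hm : 1 ≤ m) (S : Finset (Fin m)) :
    ∃ T ⊆ S, v S ≤ harmonic m * guarantee v T := by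
  -- The value of `∅` may be positive, which is why `guarantee` treats `∅` separately.
  rcases S.eq_empty_or_nonempty with rfl | hS
  · refine ⟨∅, subset_rfl, ?_⟩
    simp only [guarantee, if_true]
    exact le_mul_of_one_le_left (hv.nonneg _) (one_le_harmonic hm)
  · obtain ⟨T, hT, hmax⟩ := (S.powerset.filter Finset.Nonempty).exists_max_image
      (fun T => (rate v T : ℝ) * T.card) ⟨S, by simpa using hS⟩
    simp only [Finset.mem_filter, Finset.mem_powerset] at hT hmax
    refine ⟨T, hT.1, ?_⟩
    rw [guarantee, if_neg hT.2.ne_empty, mul_comm]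
    refine (hv.le_mul_harmonic S hS fun T' h h' => hmax T' ⟨h, h'⟩).trans ?_
    gcongr
    exact_mod_cast harmonic_mono (by simpa using Finset.card_le_univ S)

end Rate

/-! ### Target bundles -/

/-- A maximizer of finitely many measurable functions can be chosen measurably. -/
theorem exists_measurable_argmax {Ω A : Type*} [MeasurableSpace Ω] [MeasurableSpace A]
    [Countable A] [MeasurableSingletonClass A] {f : A → Ω → ℝ} (hf : ∀ a, Measurable (f a))
    {s : Finset A} (hs : s.Nonempty) :
    ∃ σ : Ω → A, Measurable σ ∧ ∀ x, σ x ∈ s ∧ ∀ a ∈ s, f a x ≤ f (σ x) x := by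
  classical
  induction hs using Finset.Nonempty.cons_induction with
  | singleton a => exact ⟨fun _ => a, measurable_const, by simp⟩
  | cons a s ha hs ih =>
    obtain ⟨σ, hσ, h⟩ := ih
    have hσf : Measurable fun x => f (σ x) x :=
      (measurable_from_prod_countable_right (f := fun p : A × Ω => f p.1 p.2) hf).comp
        (hσ.prodMk measurable_id)
    refine ⟨fun x => if f (σ x) x ≤ f a x then a else σ x,
      Measurable.ite (measurableSet_le hσf (hf a)) measurable_const hσ, fun x => ?_⟩
    simp only
    split_ifs with hx
    · refine ⟨by simp, fun a' ha' => ?_⟩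
      rcases Finset.mem_cons.1 ha' with rfl | ha'
      exacts [le_rfl, ((h x).2 a' ha').trans hx]
    · refine ⟨Finset.mem_cons.2 (Or.inr (h x).1), fun a' ha' => ?_⟩
      rcases Finset.mem_cons.1 ha' with rfl | ha'
      exacts [(not_le.1 hx).le, (h x).2 a' ha']

/-- The choice has to be measurable in the valuations, because the deviation is later applied to
random profiles. -/
theorem exists_targets (n m : ℕ) :
    ∃ T : (Fin n → BundleValuation m) → Fin n → Finset (Fin m), Measurable T ∧
      (∀ v, Pairwise fun i j => Disjoint (T v i) (T v j)) ∧
      ∀ v (T' : Fin n → Finset (Fin m)), (Pairwise fun i j => Disjoint (T' i) (T' j)) →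
        ∑ i, guarantee (v i) (T' i) ≤ ∑ i, guarantee (v i) (T v i) := by
  classical
  obtain ⟨T, hT, h⟩ := exists_measurable_argmax
    (f := fun (T : Fin n → Finset (Fin m)) (v : Fin n → BundleValuation m) =>
      ∑ i, guarantee (v i) (T i))
    (fun T => Finset.measurable_sum _ fun i _ =>
      (measurable_guarantee (T i)).comp (measurable_pi_apply i))
    (s := Finset.univ.filter fun T => Pairwise fun i j => Disjoint (T i) (T j))
    ⟨fun _ => ∅, Finset.mem_filter.2 ⟨Finset.mem_univ _, fun _ _ _ => Finset.disjoint_empty_left _⟩⟩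
  simp only [Finset.mem_filter, Finset.mem_univ, true_and] at h
  exact ⟨T, hT, fun v => (h v).1, fun v => (h v).2⟩

/-- Disjoint bundles that maximize the sum of the guarantees. -/
noncomputable def targets {n m : ℕ} : (Fin n → BundleValuation m) → Fin n → Finset (Fin m) :=
  (exists_targets n m).choose

theorem measurable_targets {n m : ℕ} :
    Measurable (targets : (Fin n → BundleValuation m) → Fin n → Finset (Fin m)) :=
  (exists_targets n m).choose_spec.1

theorem disjoint_targets {n m : ℕ} (v : Fin n → BundleValuation m) :
    Pairwise fun i j => Disjoint (targets v i) (targets v j) :=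
  (exists_targets n m).choose_spec.2.1 v

theorem sum_guarantee_le_targets {n m : ℕ} (v : Fin n → BundleValuation m)
    {T : Fin n → Finset (Fin m)} (hT : Pairwise fun i j => Disjoint (T i) (T j)) :
    ∑ i, guarantee (v i) (T i) ≤ ∑ i, guarantee (v i) (targets v i) :=
  (exists_targets n m).choose_spec.2.2 v T hT

theorem optWelfare_nonneg {n m : ℕ} {w : Fin n → BundleValuation m}
    (hw : ∀ i, IsSubadditiveValuation (w i)) : 0 ≤ optWelfare w :=
  Real.iSup_nonneg fun _ => Finset.sum_nonneg fun i _ => (hw i).nonneg _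

/-- Shrinking each bundle of a partition to its best subset keeps the bundles disjoint, so the
targets do at least as well. -/
theorem optWelfare_le_sum_guarantee {n m : ℕ} [NeZero n] (hm : 1 ≤ m)
    {v : Fin n → BundleValuation m} (hv : ∀ i, IsSubadditiveValuation (v i)) :
    optWelfare v ≤ harmonic m * ∑ i, guarantee (v i) (targets v i) := by
  refine ciSup_le fun a => ?_
  choose T hT h using fun i => (hv i).exists_guarantee hm (Finset.univ.filter fun j => a j = i)
  have hd : Pairwise fun i j => Disjoint (T i) (T j) := fun i j hij =>
    Finset.disjoint_of_subset_left (hT i) (Finset.disjoint_of_subset_right (hT j)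
      (Finset.disjoint_filter.2 fun x _ h₁ h₂ => hij (h₁ ▸ h₂)))
  calc _ ≤ ∑ i, harmonic m * guarantee (v i) (T i) := Finset.sum_le_sum fun i _ => h i
    _ = harmonic m * ∑ i, guarantee (v i) (T i) := by rw [Finset.mul_sum]
    _ ≤ _ := by
      refine mul_le_mul_of_nonneg_left (sum_guarantee_le_targets v hd) ?_
      exact zero_le_one.trans (one_le_harmonic hm)

/-! ### Smoothness -/

section Smooth

variable {n m : ℕ}

/-- The deviation of bidder `i` that aims at her target bundle for the valuation profile `w`. -/
noncomputable def smoothDev (w : Fin n → BundleValuation m) (i : Fin n) (b : Strategy n m) :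
    Strategy n m :=
  homogeneousDev (targets w i) (rate (w i) (targets w i) / 2) b

variable [NeZero n] (tb : TieBreak n m) (b : Fin n → Strategy n m)
  {w : Fin n → BundleValuation m}

/-- This bound serves only the integrability of the deviation's utility. -/
theorem payment_smoothDev_le {i : Fin n} (hw : IsSubadditiveValuation (w i)) :
    payment (outcome tb (Function.update b i (smoothDev w i (b i)))) i ≤
      payment (outcome tb b) i + w i Finset.univ := by
  obtain ⟨k, h₁, -, h₃⟩ := targetSold_outcome_homogeneousDev i (targets w i)
    (rate (w i) (targets w i) / 2) tb b
  have hk : (k : ℝ) ≤ (targets w i).card := by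
    exact_mod_cast h₃.trans (Finset.card_le_card Finset.inter_subset_left)
  have := rate_mul_card_le hw.nonneg (subset_refl (targets w i))
  have h₄ := hw.mono _ _ (Finset.subset_univ (targets w i))
  have h₅ : (rate (w i) (targets w i) : ℝ) * k ≤ rate (w i) (targets w i) * (targets w i).card := by
    gcongr
  have h₆ : 0 ≤ (rate (w i) (targets w i) : ℝ) * k := by positivity
  push_cast at h₁
  exact h₁.trans (by linarith)

/-- With `q = rate / 2`, the `k` items bought are worth at least `2 q k` and raise the payment by at
most `q k`. The utility is thus at least `q k - P_i`, and `q k` is at least `q |T|` minus the money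
spent on `T`. -/
theorem le_utility_smoothDev {i : Fin n} (hw : IsSubadditiveValuation (w i)) :
    guarantee (w i) (targets w i) / 2 - payment (outcome tb b) i -
        spent (outcome tb b) (targets w i) ≤
      utility tb (Function.update b i (smoothDev w i (b i))) i (w i) := by
  obtain ⟨k, h₁, h₂, h₃⟩ := targetSold_outcome_homogeneousDev i (targets w i)
    (rate (w i) (targets w i) / 2) tb b
  change _ ≤ w i (allocation (outcome tb (Function.update b i (homogeneousDev _ _ _))) i) -
    payment (outcome tb (Function.update b i (homogeneousDev _ _ _))) i
  set A := allocation (outcome tb (Function.update b i (homogeneousDev (targets w i)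
    (rate (w i) (targets w i) / 2) (b i)))) i
  push_cast at h₁ h₂
  have h₄ : (rate (w i) (targets w i) : ℝ) * k ≤ w i A :=
    calc (rate (w i) (targets w i) : ℝ) * k
        ≤ rate (w i) (targets w i) * (targets w i ∩ A).card := by gcongr
      _ ≤ w i (targets w i ∩ A) := rate_mul_card_le hw.nonneg Finset.inter_subset_left
      _ ≤ w i A := hw.mono _ _ Finset.inter_subset_right
  rcases eq_or_ne (targets w i) ∅ with h | h
  · have hk : k = 0 := by simpa [h] using h₃
    have h₅ := hw.mono ∅ A (Finset.empty_subset _)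
    have h₆ := hw.nonneg ∅
    rw [guarantee, if_pos h]
    rw [hk] at h₁ h₂
    simp only [h, Finset.card_empty, Nat.cast_zero, mul_zero, add_zero] at h₁ h₂ ⊢
    linarith
  · rw [guarantee, if_neg h]
    linarith

/-- The factor `2` arises because the bidders' own payments and the money spent on the targets each
sum to at most the revenue. -/
theorem smoothness (hm : 1 ≤ m) (hw : ∀ i, IsSubadditiveValuation (w i)) :
    1 / (2 * harmonic m) * optWelfare w - 2 * ∑ i, payment (outcome tb b) i ≤
      ∑ i, utility tb (Function.update b i (smoothDev w i (b i))) i (w i) := by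
  have hH := zero_lt_one.trans_le (one_le_harmonic hm)
  have h₁ : 1 / (2 * harmonic m) * optWelfare w ≤ (∑ i, guarantee (w i) (targets w i)) / 2 := by
    rw [div_mul_eq_mul_div, one_mul, div_le_iff₀ (by positivity)]
    linarith [optWelfare_le_sum_guarantee hm hw]
  have h₂ := Finset.sum_le_sum fun i (_ : i ∈ Finset.univ) => le_utility_smoothDev tb b (hw i)
  rw [Finset.sum_sub_distrib, Finset.sum_sub_distrib, ← Finset.sum_div] at h₂
  have h₃ := sum_spent_le_sum_payment (outcome tb b) _ (disjoint_targets w)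
  linarith

theorem isSmooth (hm : 2 ≤ m) : IsSmooth tb IsSubadditiveValuation
    (1 / (8 * (harmonic m : ℝ) * (Real.log ((m : ℝ) - 1) + 1))) 2 := by
  intro v hv
  refine ⟨smoothDev v, fun b => le_trans ?_ (smoothness tb b (by omega) hv)⟩
  have hH := zero_lt_one.trans_le (one_le_harmonic (show 1 ≤ m by omega))
  have hlog : 0 ≤ Real.log ((m : ℝ) - 1) := by
    have : (2 : ℝ) ≤ m := by exact_mod_cast hm
    exact Real.log_nonneg (by linarith)
  -- The stated constant is weaker: `2 H_m ≤ 8 H_m (log (m - 1) + 1)`, as `log (m - 1) ≥ 0`.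
  refine sub_le_sub_right (mul_le_mul_of_nonneg_right ?_ (optWelfare_nonneg hv)) _
  refine one_div_le_one_div_of_le (by positivity) ?_
  nlinarith [mul_nonneg hH.le hlog]

end Smooth

/-! ### Measurability -/

section Measurability

variable {n m : ℕ} {Ω Ω' : Type*} [MeasurableSpace Ω] [MeasurableSpace Ω']

/-- A family of strategies whose actions are jointly measurable in the parameter and the
history. -/
def MeasurableFamily (f : Ω → Strategy n m) : Prop :=
  ∀ t, Measurable fun x : Ω × History n m t => (f x.1).act t x.2

theorem MeasurableFamily.comp {f : Ω → Strategy n m} (hf : MeasurableFamily f) {g : Ω' → Ω}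
    (hg : Measurable g) : MeasurableFamily fun x => f (g x) := fun t =>
  (hf t).comp ((hg.comp measurable_fst).prodMk measurable_snd)

theorem measurableFamily_const (b : Strategy n m) : MeasurableFamily fun _ : Ω => b := fun t =>
  (b.measurable_act t).comp measurable_snd

theorem MeasurableFamily.act {f : Ω → Strategy n m} (hf : MeasurableFamily f) {t : ℕ}
    {h : Ω → History n m t} (hh : Measurable h) : Measurable fun x => (f x).act t (h x) :=
  (hf t).comp (measurable_id.prodMk hh)

theorem measurableFamily_update {b : Ω → Fin n → Strategy n m}
    (hb : ∀ j, MeasurableFamily fun x => b x j) (i : Fin n) {d : Ω → Strategy n m}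
    (hd : MeasurableFamily d) (j : Fin n) :
    MeasurableFamily fun x => Function.update (b x) i (d x) j := by
  by_cases h : j = i
  · subst h
    simpa using hd
  · simpa [h] using hb j

theorem measurable_apply_bundle {v : Ω → BundleValuation m} (hv : Measurable v)
    {S : Ω → Finset (Fin m)} (hS : Measurable S) : Measurable fun x => v x (S x) :=
  (measurable_from_prod_countable_left
    (f := fun p : BundleValuation m × Finset (Fin m) => p.1 p.2)
    fun S => measurable_pi_apply S).comp (hv.prodMk hS)

theorem measurableFamily_smoothDev {w : Ω → Fin n → BundleValuation m} (hw : Measurable w)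
    (i : Fin n) {b : Ω → Strategy n m} (hb : MeasurableFamily b) :
    MeasurableFamily fun x => smoothDev (w x) i (b x) := by
  intro t
  have hT : Measurable fun x => targets (w x) i :=
    (measurable_pi_apply i).comp (measurable_targets.comp hw)
  have hr : Measurable fun x => rate (w x i) (targets (w x) i) :=
    (measurable_from_prod_countable_left
      (f := fun p : BundleValuation m × Finset (Fin m) => rate p.1 p.2) measurable_rate).comp
      (((measurable_pi_apply i).comp hw).prodMk hT)
  exact measurable_homogeneousAction.comp
    ((hT.comp measurable_fst).prodMk (((hr.comp measurable_fst).div_const 2).prodMk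
      (((measurable_remaining t).comp measurable_snd).prodMk (hb t))))

theorem measurable_allocation (t : ℕ) (i : Fin n) :
    Measurable fun h : History n m t => allocation h i := by
  have : (fun h : History n m t => allocation h i) =
      (fun X : Fin t → Fin n × Finset (Fin m) =>
        (Finset.univ.filter (fun s => (X s).1 = i)).biUnion fun s => (X s).2) ∘
        fun h s => ((h s).1, (h s).2.2) := rfl
  rw [this]
  refine (Measurable.of_discrete).comp (measurable_pi_lambda _ fun s => ?_)
  exact (measurable_pi_apply s).fst.prodMk (measurable_pi_apply s).snd.snd

theorem measurable_payment (t : ℕ) (i : Fin n) :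
    Measurable fun h : History n m t => payment h i := by
  refine Finset.measurable_sum _ fun s _ => ?_
  have hs : Measurable fun h : History n m t => h s := measurable_pi_apply s
  refine Measurable.ite (hs.fst (measurableSet_singleton i)) ?_ measurable_const
  refine hs.snd.fst.coe_nnreal_real.mul ?_
  exact (Measurable.of_discrete (f := fun S : Finset (Fin m) => (S.card : ℝ))).comp hs.snd.snd

theorem measurable_optWelfare :
    Measurable (optWelfare : (Fin n → BundleValuation m) → ℝ) := by
  refine Measurable.iSup fun a => Finset.measurable_sum _ fun i _ => ?_
  exact (measurable_pi_apply _).comp (measurable_pi_apply i)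

variable [NeZero n] (tb : TieBreak n m)

theorem measurable_play {b : Ω → Fin n → Strategy n m}
    (hb : ∀ i, MeasurableFamily fun x => b x i) (t : ℕ) :
    Measurable fun x => play tb (b x) t := by
  induction t with
  | zero => exact measurable_const
  | succ t ih =>
    have hrank : ∀ i, Measurable fun x => tb.rank t (play tb (b x) t) i := fun i =>
      (tb.measurable_rank t i).comp ih
    have hbid : ∀ i, Measurable fun x => ((b x i).act t (play tb (b x) t)).1 := fun i =>
      ((hb i).act ih).fst
    have hw : Measurable fun x => nextWinner tb (b x) t := by
      refine measurable_to_countable' fun i => ?_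
      -- Winning amounts to finitely many comparisons of bids and ranks.
      have : (fun x => nextWinner tb (b x) t) ⁻¹' {i} = ⋂ j,
          ({x | ((b x j).act t (play tb (b x) t)).1 < ((b x i).act t (play tb (b x) t)).1} ∪
          ({x | ((b x j).act t (play tb (b x) t)).1 = ((b x i).act t (play tb (b x) t)).1} ∩
          {x | tb.rank t (play tb (b x) t) j ≤ tb.rank t (play tb (b x) t) i})) := by
        ext x
        simp [nextWinner, winner_eq_iff]
      rw [this]
      refine MeasurableSet.iInter fun j => (measurableSet_lt (hbid j) (hbid i)).union
        ((measurableSet_eq_fun (hbid j) (hbid i)).inter ?_)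
      exact ((hrank j).prodMk (hrank i))
        (MeasurableSet.of_discrete (s := {p : Fin n × Fin n | p.1 ≤ p.2}))
    have hact : Measurable fun x => (b x (nextWinner tb (b x) t)).act t (play tb (b x) t) :=
      (measurable_from_prod_countable_right
        (f := fun p : Fin n × Ω => (b p.2 p.1).act t (play tb (b p.2) t))
        fun i => (hb i).act ih).comp (hw.prodMk measurable_id)
    refine measurable_pi_lambda _ fun s => ?_
    simp only [play_succ]
    refine Fin.lastCases ?_ (fun s => ?_) s
    · simpa using hw.prodMk hact
    · simpa using measurable_pi_iff.1 ih s

theorem measurable_payment_outcome {b : Ω → Fin n → Strategy n m}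
    (hb : ∀ i, MeasurableFamily fun x => b x i) (i : Fin n) :
    Measurable fun x => payment (outcome tb (b x)) i :=
  (measurable_payment m i).comp (measurable_play tb hb m)

theorem measurable_value_outcome {b : Ω → Fin n → Strategy n m}
    (hb : ∀ i, MeasurableFamily fun x => b x i) (i : Fin n)
    {v : Ω → BundleValuation m} (hv : Measurable v) :
    Measurable fun x => v x (allocation (outcome tb (b x)) i) :=
  measurable_apply_bundle hv ((measurable_allocation m i).comp (measurable_play tb hb m))

end Measurability

/-! ### From smoothness to equilibria -/

/-- Exchanging one coordinate between two independent copies preserves the law. -/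
theorem measurePreserving_swapCoordinate {ι : Type*} [Fintype ι] [DecidableEq ι]
    {α : ι → Type*} [∀ i, MeasurableSpace (α i)] (μ : ∀ i, Measure (α i))
    [∀ i, IsProbabilityMeasure (μ i)] (i : ι) :
    MeasurePreserving (fun p : (∀ i, α i) × (∀ i, α i) =>
        (Function.update p.1 i (p.2 i), Function.update p.2 i (p.1 i)))
      ((Measure.pi μ).prod (Measure.pi μ)) ((Measure.pi μ).prod (Measure.pi μ)) := by
  have hupd : Measurable fun p : (∀ i, α i) × (∀ i, α i) => Function.update p.1 i (p.2 i) := by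
    refine measurable_pi_lambda _ fun j => ?_
    by_cases h : j = i
    · subst h
      simpa using measurable_pi_iff.1 measurable_snd j
    · simpa [h] using measurable_pi_iff.1 measurable_fst j
  have hm : Measurable fun p : (∀ i, α i) × (∀ i, α i) =>
      (Function.update p.1 i (p.2 i), Function.update p.2 i (p.1 i)) :=
    hupd.prodMk (hupd.comp measurable_swap)
  refine ⟨hm, (Measure.prod_eq_generateFrom generateFrom_pi generateFrom_pi isPiSystem_pi
    isPiSystem_pi (Measure.FiniteSpanningSetsIn.pi fun i => (μ i).toFiniteSpanningSetsIn)
    (Measure.FiniteSpanningSetsIn.pi fun i => (μ i).toFiniteSpanningSetsIn) ?_).symm⟩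
  rintro _ ⟨s, hs, rfl⟩ _ ⟨t, ht, rfl⟩
  have hs' : ∀ j, MeasurableSet (s j) := fun j => hs j trivial
  have ht' : ∀ j, MeasurableSet (t j) := fun j => ht j trivial
  rw [Measure.map_apply hm ((MeasurableSet.univ_pi hs').prod (MeasurableSet.univ_pi ht'))]
  -- Swapping the coordinates swaps the sides `i` of the two boxes, which permutes the factors of
  -- the product measure.
  have hpre : (fun p : (∀ i, α i) × (∀ i, α i) =>
      (Function.update p.1 i (p.2 i), Function.update p.2 i (p.1 i))) ⁻¹'
        (Set.univ.pi s ×ˢ Set.univ.pi t) =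
      Set.univ.pi (Function.update s i (t i)) ×ˢ Set.univ.pi (Function.update t i (s i)) := by
    ext p
    simp only [Set.mem_preimage, Set.mem_prod, Set.mem_univ_pi]
    rw [Function.forall_update_iff p.1 (p := fun j x => x ∈ s j),
      Function.forall_update_iff p.2 (p := fun j x => x ∈ t j),
      Function.forall_update_iff s (p := fun j x => p.1 j ∈ x),
      Function.forall_update_iff t (p := fun j x => p.2 j ∈ x)]
    tauto
  have hprod : ∀ (s : ∀ j, Set (α j)) (x : Set (α i)),
      ∏ j, μ j (Function.update s i x j) = μ i x * ∏ j ∈ {i}ᶜ, μ j (s j) := fun s x => by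
    rw [Fintype.prod_eq_mul_prod_compl i, Function.update_self]
    congr 1
    exact Finset.prod_congr rfl fun j hj => by
      rw [Function.update_of_ne (by simpa using hj)]
  rw [hpre, Measure.prod_prod, Measure.pi_pi, Measure.pi_pi, Measure.pi_pi, Measure.pi_pi,
    hprod, hprod, Fintype.prod_eq_mul_prod_compl i, Fintype.prod_eq_mul_prod_compl i]
  ring

/-- Only the unconditional form of the best-response condition is needed below. -/
theorem integral_le_of_condExp_le {Ω : Type*} {m₀ mΩ : MeasurableSpace Ω} {μ : Measure Ω}
    [IsFiniteMeasure μ] (hm : m₀ ≤ mΩ) {f g : Ω → ℝ} (h : μ[f | m₀] ≤ᵐ[μ] μ[g | m₀]) :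
    ∫ x, f x ∂μ ≤ ∫ x, g x ∂μ := by
  rw [← integral_condExp hm, ← integral_condExp (f := g) hm]
  exact integral_mono_ae integrable_condExp integrable_condExp h

/-- The strategy that always bids `0`. -/
noncomputable def zeroStrategy (n m : ℕ) : Strategy n m where
  act _ h := (0, remaining h)
  measurable_act t := measurable_const.prodMk (measurable_remaining t)
  subset_remaining _ _ := subset_rfl
  nonempty_of_remaining _ _ h := h

/-! ### Expected values, payments and utilities -/

section Accounting

variable {n m : ℕ} [NeZero n] (tb : TieBreak n m) {Ω : Type*} [MeasurableSpace Ω] {μ : Measure Ω}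
  {b : Ω → Fin n → Strategy n m} {v : Ω → Fin n → BundleValuation m}

theorem utility_zeroStrategy (b : Fin n → Strategy n m) (i : Fin n) (v : BundleValuation m) :
    utility tb (Function.update b i (zeroStrategy n m)) i v =
      v (allocation (outcome tb (Function.update b i (zeroStrategy n m))) i) := by
  rw [utility, outcome, payment_play_eq_zero tb _ (fun t h => by simp [zeroStrategy]), sub_zero]

theorem integrable_value (hb : ∀ i, MeasurableFamily fun x => b x i) {i : Fin n}
    {v : Ω → BundleValuation m} (hv : Measurable v) (hsub : ∀ᵐ x ∂μ, IsSubadditiveValuation (v x))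
    (hint : Integrable (fun x => v x Finset.univ) μ) :
    Integrable (fun x => v x (allocation (outcome tb (b x)) i)) μ := by
  refine hint.mono' (measurable_value_outcome tb hb i hv).aestronglyMeasurable ?_
  filter_upwards [hsub] with x hx
  rw [Real.norm_of_nonneg (hx.nonneg _)]
  exact hx.mono _ _ (Finset.subset_univ _)

/-- The payment is value minus utility, and the value is dominated by `v([m])`. -/
theorem integrable_payment (hb : ∀ i, MeasurableFamily fun x => b x i) {i : Fin n}
    {v : Ω → BundleValuation m} (hv : Measurable v) (hsub : ∀ᵐ x ∂μ, IsSubadditiveValuation (v x))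
    (hint : Integrable (fun x => v x Finset.univ) μ)
    (hu : Integrable (fun x => utility tb (b x) i (v x)) μ) :
    Integrable (fun x => payment (outcome tb (b x)) i) μ := by
  refine ((integrable_value tb hb (i := i) hv hsub hint).sub hu).congr (.of_forall fun x => ?_)
  simp [utility]

/-- The utility of the deviation is integrable if the payments and the values are. -/
theorem integrable_utility_smoothDev (hb : ∀ i, MeasurableFamily fun x => b x i)
    (hv : Measurable v) (hsub : ∀ i, ∀ᵐ x ∂μ, IsSubadditiveValuation (v x i))
    (hint : ∀ i, Integrable (fun x => v x i Finset.univ) μ)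
    (hP : ∀ i, Integrable (fun x => payment (outcome tb (b x)) i) μ) (i : Fin n) :
    Integrable (fun x =>
      utility tb (Function.update (b x) i (smoothDev (v x) i (b x i))) i (v x i)) μ := by
  have hb' := measurableFamily_update hb i (measurableFamily_smoothDev hv i (hb i))
  have hvi : Measurable fun x => v x i := (measurable_pi_apply i).comp hv
  refine (integrable_value tb hb' hvi (hsub i) (hint i)).sub ?_
  refine ((hP i).add (hint i)).mono'
    (measurable_payment_outcome tb hb' i).aestronglyMeasurable ?_
  filter_upwards [hsub i] with x hx
  rw [Real.norm_of_nonneg (payment_nonneg _ _)]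
  exact payment_smoothDev_le tb (b x) hx

theorem integrable_optWelfare (hv : Measurable v)
    (hsub : ∀ i, ∀ᵐ x ∂μ, IsSubadditiveValuation (v x i))
    (hint : ∀ i, Integrable (fun x => v x i Finset.univ) μ) :
    Integrable (fun x => optWelfare (v x)) μ := by
  refine (integrable_finsetSum Finset.univ fun i _ => hint i).mono'
    (measurable_optWelfare.comp hv).aestronglyMeasurable ?_
  filter_upwards [ae_all_iff.2 hsub] with x hx
  rw [Real.norm_of_nonneg (optWelfare_nonneg hx)]
  exact ciSup_le fun a => Finset.sum_le_sum fun i _ => (hx i).mono _ _ (Finset.subset_univ _)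

/-- Strategies and valuations are arbitrary functions of a sample point, so they may also come from
different independent copies. -/
theorem integral_smoothness (hm : 1 ≤ m) (hb : ∀ i, MeasurableFamily fun x => b x i)
    (hv : Measurable v) (hsub : ∀ i, ∀ᵐ x ∂μ, IsSubadditiveValuation (v x i))
    (hint : ∀ i, Integrable (fun x => v x i Finset.univ) μ)
    (hP : ∀ i, Integrable (fun x => payment (outcome tb (b x)) i) μ) :
    1 / (2 * harmonic m) * ∫ x, optWelfare (v x) ∂μ -
        2 * ∑ i, ∫ x, payment (outcome tb (b x)) i ∂μ ≤
      ∑ i, ∫ x, utility tb (Function.update (b x) i (smoothDev (v x) i (b x i))) i (v x i) ∂μ := by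
  have hO := (integrable_optWelfare hv hsub hint).const_mul (1 / (2 * (harmonic m : ℝ)))
  have hPs := (integrable_finsetSum Finset.univ fun i _ => hP i).const_mul 2
  rw [← integral_finsetSum _ fun i _ => hP i, ← integral_const_mul, ← integral_const_mul,
    ← integral_sub hO hPs, ← integral_finsetSum _ fun i _ =>
      integrable_utility_smoothDev tb hb hv hsub hint hP i]
  refine integral_mono_ae (hO.sub hPs) (integrable_finsetSum _ fun i _ =>
    integrable_utility_smoothDev tb hb hv hsub hint hP i) ?_
  filter_upwards [ae_all_iff.2 hsub] with x hx
  exact smoothness tb (b x) hm hx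

/-- If the expected utilities are non-negative, the payments are covered by the welfare. -/
theorem le_two_mul_integral_welfare (hb : ∀ i, MeasurableFamily fun x => b x i)
    (hv : Measurable v) (hsub : ∀ i, ∀ᵐ x ∂μ, IsSubadditiveValuation (v x i))
    (hint : ∀ i, Integrable (fun x => v x i Finset.univ) μ)
    (hu : ∀ i, Integrable (fun x => utility tb (b x) i (v x i)) μ)
    (hu₀ : ∀ i, 0 ≤ ∫ x, utility tb (b x) i (v x i) ∂μ) {r : ℝ}
    (hr : r - 2 * ∑ i, ∫ x, payment (outcome tb (b x)) i ∂μ ≤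
      ∑ i, ∫ x, utility tb (b x) i (v x i) ∂μ) :
    r ≤ 2 * ∫ x, welfare tb (b x) (v x) ∂μ := by
  have hvi : ∀ i, Measurable fun x => v x i := fun i => (measurable_pi_apply i).comp hv
  have hV := fun i => integrable_value tb hb (i := i) (hvi i) (hsub i) (hint i)
  have hP := fun i => integrable_payment tb hb (i := i) (hvi i) (hsub i) (hint i) (hu i)
  have hW : ∫ x, welfare tb (b x) (v x) ∂μ =
      ∑ i, ∫ x, v x i (allocation (outcome tb (b x)) i) ∂μ :=
    integral_finsetSum _ fun i _ => hV i
  have hU : ∑ i, ∫ x, utility tb (b x) i (v x i) ∂μ =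
      ∑ i, ∫ x, v x i (allocation (outcome tb (b x)) i) ∂μ -
        ∑ i, ∫ x, payment (outcome tb (b x)) i ∂μ := by
    rw [← Finset.sum_sub_distrib]
    exact Finset.sum_congr rfl fun i _ => integral_sub (hV i) (hP i)
  -- With total expected payment `P` and welfare `W`, `hr` reads `r ≤ W + P`, and non-negative
  -- utilities give `P ≤ W`.
  have := Finset.sum_nonneg fun i (_ : i ∈ Finset.univ) => hu₀ i
  rw [hW]
  linarith

theorem integral_welfare_nonneg (hsub : ∀ i, ∀ᵐ x ∂μ, IsSubadditiveValuation (v x i)) :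
    0 ≤ ∫ x, welfare tb (b x) (v x) ∂μ := by
  refine integral_nonneg_of_ae ?_
  filter_upwards [ae_all_iff.2 hsub] with x hx
  exact Finset.sum_nonneg fun i _ => (hx i).nonneg _

end Accounting

/-! ### Welfare bounds for correlated and Bayes–Nash equilibria -/

section Equilibria

variable {n m : ℕ} {Θ : Fin n → Type u} [∀ i, MeasurableSpace (Θ i)]

theorem measurePreserving_bayesLaw (D : Fin n → Measure (BundleValuation m))
    [∀ i, IsProbabilityMeasure (D i)] (κ : ∀ i, Kernel (BundleValuation m) (Θ i))
    [∀ i, IsMarkovKernel (κ i)] :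
    MeasurePreserving (fun (ω : ∀ i, BundleValuation m × Θ i) i => (ω i).1)
      (bayesLaw D κ) (Measure.pi D) := by
  refine ⟨measurable_pi_lambda _ fun i => (measurable_pi_apply i).fst, ?_⟩
  have hfst : ∀ i, Measure.map Prod.fst (D i ⊗ₘ κ i) = D i := fun i => Measure.fst_compProd _ _
  have : ∀ i, SigmaFinite (Measure.map Prod.fst (D i ⊗ₘ κ i)) := fun i => by
    rw [hfst i]
    infer_instance
  rw [bayesLaw, Measure.pi_map_pi (f := fun i => (Prod.fst : BundleValuation m × Θ i → _))
    fun i => measurable_fst.aemeasurable]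
  simp only [hfst]

variable [NeZero n] (tb : TieBreak n m)

/-- The deviation uses only the known profile `v` and the bidder's own suggestion, so correlation
between the suggestions does no harm. -/
theorem IsCorrelatedEq.optWelfare_le (hm : 1 ≤ m) {v : Fin n → BundleValuation m}
    (hv : ∀ i, IsSubadditiveValuation (v i)) {X : Measure (∀ i, Θ i)} [IsProbabilityMeasure X]
    {s : ∀ i, StrategyFamily n m (Θ i)} (h : IsCorrelatedEq tb v X s) :
    1 / (2 * harmonic m) * optWelfare v ≤
      2 * ∫ θ, welfare tb (fun j => s j (θ j)) v ∂X := by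
  have hs : ∀ i, MeasurableFamily (s i).toFun := fun i => (s i).measurable_toFun
  have hb : ∀ i, MeasurableFamily fun θ : ∀ i, Θ i => s i (θ i) := fun i =>
    (hs i).comp (measurable_pi_apply i)
  have hsub : ∀ i, ∀ᵐ θ ∂X, IsSubadditiveValuation (v i) := fun i => .of_forall fun _ => hv i
  have hint : ∀ i, Integrable (fun _ => v i Finset.univ) X := fun i => integrable_const _
  have hP := fun i => integrable_payment tb hb (i := i) measurable_const (hsub i) (hint i)
    (h.integrable i)
  have hle : ∀ i, MeasurableSpace.comap (fun θ : ∀ i, Θ i => θ i) inferInstance ≤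
      MeasurableSpace.pi := fun i => (measurable_pi_apply i).comap_le
  refine le_two_mul_integral_welfare tb hb (v := fun _ => v) measurable_const hsub hint
    h.integrable (fun i => ?_) ?_
  · have hd := integrable_value tb (measurableFamily_update hb i
      (measurableFamily_const (zeroStrategy n m))) (i := i) (measurable_const (a := v i))
        (hsub i) (hint i)
    refine le_trans ?_ (integral_le_of_condExp_le (hle i) (h.best_response i
      ⟨fun _ => zeroStrategy n m, measurableFamily_const _⟩ ?_))
    · simp only [utility_zeroStrategy]
      exact integral_nonneg fun θ => (hv i).nonneg _
    · simpa only [utility_zeroStrategy] using hd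
  · have := integral_smoothness tb hm hb (v := fun _ => v) measurable_const hsub hint hP
    simp only [integral_const, probReal_univ, one_smul] at this
    refine this.trans (Finset.sum_le_sum fun i _ => ?_)
    exact integral_le_of_condExp_le (hle i) (h.best_response i
      ⟨fun θ => smoothDev v i (s i θ), measurableFamily_smoothDev measurable_const i (hs i)⟩
      (integrable_utility_smoothDev tb hb (v := fun _ => v) measurable_const hsub hint hP i))

/-- Against independent valuations, the deviation for a resampled profile of valuations of the
others and a resampled strategy of her own is as good for a bidder as the smoothness deviation of
a bidder with a resampled valuation. -/
theorem IsBayesNash.integral_smoothDev_le {D : Fin n → Measure (BundleValuation m)}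
    [∀ i, IsProbabilityMeasure (D i)] {κ : ∀ i, Kernel (BundleValuation m) (Θ i)}
    [∀ i, IsMarkovKernel (κ i)] {s : ∀ i, StrategyFamily n m (Θ i)} (h : IsBayesNash tb D κ s)
    (i : Fin n)
    (hg : Integrable (fun p : (∀ i, BundleValuation m × Θ i) × (∀ i, BundleValuation m × Θ i) =>
      utility tb (Function.update (fun j => s j (p.1 j).2) i
        (smoothDev (fun j => (p.2 j).1) i (s i (p.1 i).2))) i (p.2 i).1)
      ((bayesLaw D κ).prod (bayesLaw D κ))) :
    ∫ p, utility tb (Function.update (fun j => s j (p.1 j).2) i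
        (smoothDev (fun j => (p.2 j).1) i (s i (p.1 i).2))) i (p.2 i).1
        ∂((bayesLaw D κ).prod (bayesLaw D κ)) ≤
      ∫ ω, utility tb (fun j => s j (ω j).2) i (ω i).1 ∂(bayesLaw D κ) := by
  have hprob : IsProbabilityMeasure (bayesLaw D κ) := by unfold bayesLaw; infer_instance
  have hsw := measurePreserving_swapCoordinate (fun i => D i ⊗ₘ κ i) i
  rw [← show bayesLaw D κ = Measure.pi _ from rfl] at hsw
  -- For a fixed copy `ω'`, this deviation depends on the bidder's own valuation `x` alone.
  set d : (∀ i, BundleValuation m × Θ i) → StrategyFamily n m (BundleValuation m) := fun ω' =>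
    ⟨fun x => smoothDev (Function.update (fun j => (ω' j).1) i x) i (s i (ω' i).2),
      measurableFamily_smoothDev (measurable_update _) i (measurableFamily_const _)⟩ with hd
  -- After the swap, her valuation comes from the actual play, while the other valuations and her
  -- imitated strategy come from the copy.
  have heq : ∀ p : (∀ i, BundleValuation m × Θ i) × (∀ i, BundleValuation m × Θ i),
      utility tb (Function.update
        (fun j => s j (Function.update p.1 i (p.2 i) j).2) i
        (smoothDev (fun j => (Function.update p.2 i (p.1 i) j).1) i
          (s i (Function.update p.1 i (p.2 i) i).2))) i (Function.update p.2 i (p.1 i) i).1 =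
      utility tb (Function.update (fun j => s j (p.1 j).2) i (d p.2 (p.1 i).1)) i (p.1 i).1 := by
    intro p
    have h₁ : (fun j => (Function.update p.2 i (p.1 i) j).1) =
        Function.update (fun j => (p.2 j).1) i (p.1 i).1 := by
      ext1 j
      by_cases hj : j = i
      · subst hj; simp
      · simp [hj]
    have h₂ : ∀ x : Strategy n m,
        Function.update (fun j => s j (Function.update p.1 i (p.2 i) j).2) i x =
        Function.update (fun j => s j (p.1 j).2) i x := fun x => by
      ext1 j
      by_cases hj : j = i
      · subst hj; simp
      · simp [hj]
    rw [h₁, h₂, Function.update_self, Function.update_self]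
  have hG := (hsw.integrable_comp hg.aestronglyMeasurable).2 hg
  have hI := hsw.map_eq ▸ integral_map (f := fun p : (∀ i, BundleValuation m × Θ i) ×
    (∀ i, BundleValuation m × Θ i) => utility tb (Function.update (fun j => s j (p.1 j).2) i
        (smoothDev (fun j => (p.2 j).1) i (s i (p.1 i).2))) i (p.2 i).1)
        hsw.measurable.aemeasurable (hsw.map_eq.symm ▸ hg.aestronglyMeasurable)
  simp only [Function.comp_def, heq] at hG hI
  rw [hI, integral_prod_symm _ hG]
  calc _ ≤ ∫ _, ∫ ω, utility tb (fun j => s j (ω j).2) i (ω i).1 ∂(bayesLaw D κ)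
        ∂(bayesLaw D κ) := by
        refine integral_mono_ae hG.integral_prod_right (integrable_const _) ?_
        filter_upwards [hG.prod_left_ae] with ω' hω'
        exact integral_le_of_condExp_le (measurable_pi_apply i).fst.comap_le
          (h.best_response i (d ω') hω')
    _ = _ := by simp

theorem IsBayesNash.optWelfare_le (hm : 1 ≤ m) {D : Fin n → Measure (BundleValuation m)}
    [∀ i, IsProbabilityMeasure (D i)] {κ : ∀ i, Kernel (BundleValuation m) (Θ i)}
    [∀ i, IsMarkovKernel (κ i)] {s : ∀ i, StrategyFamily n m (Θ i)}
    (hD : ∀ i, ∀ᵐ v ∂(D i), IsSubadditiveValuation v)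
    (hDint : ∀ i, Integrable (fun v : BundleValuation m => v Finset.univ) (D i))
    (h : IsBayesNash tb D κ s) :
    1 / (2 * harmonic m) * ∫ v, optWelfare v ∂(Measure.pi D) ≤
      2 * ∫ ω, welfare tb (fun j => s j (ω j).2) (fun j => (ω j).1) ∂(bayesLaw D κ) := by
  have hprob : IsProbabilityMeasure (bayesLaw D κ) := by unfold bayesLaw; infer_instance
  have hval := measurePreserving_bayesLaw D κ
  have hvi : ∀ i, MeasurePreserving (fun ω : ∀ i, BundleValuation m × Θ i => (ω i).1)
      (bayesLaw D κ) (D i) := fun i => (measurePreserving_eval D i).comp hval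
  have hb : ∀ i, MeasurableFamily fun ω : ∀ i, BundleValuation m × Θ i => s i (ω i).2 := fun i =>
    MeasurableFamily.comp (f := (s i).toFun) (s i).measurable_toFun (measurable_pi_apply i).snd
  have hsub : ∀ i, ∀ᵐ ω ∂(bayesLaw D κ), IsSubadditiveValuation (ω i).1 := fun i =>
    (hvi i).quasiMeasurePreserving.ae (hD i)
  have hint : ∀ i, Integrable (fun ω : ∀ i, BundleValuation m × Θ i => (ω i).1 Finset.univ)
      (bayesLaw D κ) := fun i =>
    ((hvi i).integrable_comp (hDint i).aestronglyMeasurable).2 (hDint i)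
  have hP := fun i => integrable_payment tb hb (i := i) (hvi i).measurable (hsub i) (hint i)
    (h.integrable i)
  refine le_two_mul_integral_welfare tb hb hval.measurable hsub hint h.integrable (fun i => ?_) ?_
  · have hd := integrable_value tb (measurableFamily_update hb i
      (measurableFamily_const (zeroStrategy n m))) (i := i) (hvi i).measurable (hsub i) (hint i)
    refine le_trans ?_ (integral_le_of_condExp_le (hvi i).measurable.comap_le (h.best_response i
      ⟨fun _ => zeroStrategy n m, measurableFamily_const _⟩ ?_))
    · simp only [utility_zeroStrategy]
      refine integral_nonneg_of_ae ?_
      filter_upwards [hsub i] with ω hω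
      exact hω.nonneg _
    · simpa only [utility_zeroStrategy] using hd
  -- Smoothness is applied with strategies from the first copy and valuations from the second.
  · have hb₂ : ∀ i, MeasurableFamily fun p : (∀ i, BundleValuation m × Θ i) ×
        (∀ i, BundleValuation m × Θ i) => s i (p.1 i).2 := fun i => (hb i).comp measurable_fst
    have hv₂ : Measurable fun (p : (∀ i, BundleValuation m × Θ i) ×
        (∀ i, BundleValuation m × Θ i)) i => (p.2 i).1 := hval.measurable.comp measurable_snd
    have hsub₂ := fun i => Measure.quasiMeasurePreserving_snd (μ := bayesLaw D κ).ae (hsub i)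
    have hint₂ := fun i => (hint i).comp_snd (bayesLaw D κ)
    have hP₂ := fun i => (hP i).comp_fst (bayesLaw D κ)
    have hO : ∫ p, optWelfare (fun i => (p.2 i).1) ∂((bayesLaw D κ).prod (bayesLaw D κ)) =
        ∫ v, optWelfare v ∂(Measure.pi D) := by
      rw [integral_fun_snd (μ := bayesLaw D κ) (ν := bayesLaw D κ)
        (fun ω => optWelfare fun i => (ω i).1), ← hval.map_eq,
        integral_map hval.measurable.aemeasurable measurable_optWelfare.aestronglyMeasurable]
      simp
    have hPO : ∀ i, ∫ p, payment (outcome tb fun j => s j (p.1 j).2) i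
        ∂((bayesLaw D κ).prod (bayesLaw D κ)) =
        ∫ ω, payment (outcome tb fun j => s j (ω j).2) i ∂(bayesLaw D κ) := fun i => by
      rw [integral_fun_fst (μ := bayesLaw D κ) (ν := bayesLaw D κ)
        (fun ω => payment (outcome tb fun j => s j (ω j).2) i)]
      simp
    have hsm := integral_smoothness tb hm hb₂ hv₂ hsub₂ hint₂ hP₂
    simp only [hO, hPO] at hsm
    exact hsm.trans (Finset.sum_le_sum fun i _ => h.integral_smoothDev_le tb i
      (integrable_utility_smoothDev tb hb₂ hv₂ hsub₂ hint₂ hP₂ i))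

end Equilibria

theorem le_log_sq_mul {m : ℕ} (hm : 2 ≤ m) {x W : ℝ} (hW : 0 ≤ W)
    (h : 1 / (2 * harmonic m) * x ≤ 2 * W) : x ≤ 16 * Real.log m ^ 2 * W := by
  have hH := zero_lt_one.trans_le (one_le_harmonic (show 1 ≤ m by omega))
  rw [div_mul_eq_mul_div, one_mul, div_le_iff₀ (by positivity)] at h
  have hlog : (0.69 : ℝ) ≤ Real.log m := by
    have h₁ : Real.log 2 ≤ Real.log m :=
      Real.log_le_log (by norm_num) (by exact_mod_cast hm)
    linarith [Real.log_two_gt_d9]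
  -- For `log m ≥ 0.69`, `1 + log m ≤ 4 (log m)^2`; the constant is `16 = 2 · 2 · 4`.
  have h₂ : (harmonic m : ℝ) ≤ 4 * Real.log m ^ 2 :=
    (harmonic_le_one_add_log m).trans (by nlinarith)
  calc x ≤ 2 * W * (2 * harmonic m) := h
    _ ≤ 2 * W * (2 * (4 * Real.log m ^ 2)) := by gcongr
    _ = _ := by ring

end DraftAuction

theorem theorem1 :
    -- smoothness
    (∀ (n m : ℕ) [NeZero n] (tb : TieBreak n m), 2 ≤ m →
      IsSmooth tb IsSubadditiveValuation
        (1 / (8 * (harmonic m : ℝ) * (Real.log ((m : ℝ) - 1) + 1))) 2) ∧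
    -- price of anarchy, with a universal constant
    ∃ C : ℝ, 0 < C ∧ ∀ (n m : ℕ) [NeZero n] (tb : TieBreak n m), 2 ≤ m →
      -- mixed Bayes–Nash equilibria, independent valuations
      (∀ (Θ : Fin n → Type u) [∀ i, MeasurableSpace (Θ i)]
        (D : Fin n → Measure (BundleValuation m)) [∀ i, IsProbabilityMeasure (D i)]
        (κ : ∀ i, Kernel (BundleValuation m) (Θ i)) [∀ i, IsMarkovKernel (κ i)]
        (s : ∀ i, StrategyFamily n m (Θ i)),
        (∀ i, ∀ᵐ v ∂(D i), IsSubadditiveValuation v) →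
        (∀ i, Integrable (fun v : BundleValuation m => v Finset.univ) (D i)) →
        IsBayesNash tb D κ s →
        ∫ v, optWelfare v ∂(Measure.pi D) ≤
          C * Real.log m ^ 2 *
            ∫ ω, welfare tb (fun j => s j (ω j).2) (fun j => (ω j).1) ∂(bayesLaw D κ)) ∧
      -- correlated equilibria, complete information
      (∀ (v : Fin n → BundleValuation m), (∀ i, IsSubadditiveValuation (v i)) →
        ∀ (Θ : Fin n → Type u) [∀ i, MeasurableSpace (Θ i)]
        (X : Measure (∀ i, Θ i)) [IsProbabilityMeasure X]
        (s : ∀ i, StrategyFamily n m (Θ i)),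
        IsCorrelatedEq tb v X s →
        optWelfare v ≤
          C * Real.log m ^ 2 * ∫ θ, welfare tb (fun j => s j (θ j)) v ∂X) := by
  refine ⟨fun n m _ tb hm => isSmooth tb hm, 16, by norm_num, fun n m _ tb hm => ⟨?_, ?_⟩⟩
  · intro Θ _ D _ κ _ s hD hint h
    refine le_log_sq_mul hm (integral_welfare_nonneg tb fun i => ?_)
      (h.optWelfare_le tb (by omega) hD hint)
    exact ((measurePreserving_eval D i).comp
      (measurePreserving_bayesLaw D κ)).quasiMeasurePreserving.ae (hD i)
  · intro v hv Θ _ X _ s h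
    exact le_log_sq_mul hm (integral_welfare_nonneg tb fun i => .of_forall fun _ => hv i)
      (h.optWelfare_le tb (by omega) hv)
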